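/- Fix an algebraic closure $\overline{\mathbb Q}$ of $\mathbb Q$ and let $H$ denote the absolute multiplicative Weil height on $\overline{\mathbb Q}$. A set $A\subseteq\overline{\mathbb Q}$ has the Northcott property if for every positive real $X$ there are only finitely many $\alpha\in A$ with $H(\alpha)\le X$. For a prime number $p$, a monic polynomial $D=x^d+a_1x^{d-1}+\dots+a_d\in\mathbb Z[x]$ is called $p$-Eisenstein if $p\mid a_j$ for $1\le j\le d$ and $p^2\nmid a_d$. Theorem. Let $K\subseteq\overline{\mathbb Q}$ be a number field, let $p_1,p_2,p_3,\dots$ be a sequence of prime numbers, and for each $i\ge 1$ let $D_i\in\mathbb Z[x]$ be a $p_i$-Eisenstein polynomial of degree $d_i\geq 1$ and let $\alpha_i\in\overline{\mathbb Q}$ be any root of $D_i$. Suppose that $p_i\nmid\Delta_{\mathbb Q(\alpha_j)}$ for all $1\le j<i$, where $\Delta_F$ denotes the absolute discriminant of a number field $F$, and that $p_i^{1/d_i}\to\infty$ as $i\to\infty$. Then the field $K(\alpha_1,\alpha_2,\alpha_3,\dots)$ has the Northcott property. -/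

import Mathlib

open Filter Polynomial IntermediateField

/-- A simple extension `ℚ(x)` inside an algebraic closure of `ℚ` is a number field
(so that its discriminant makes sense). -/
instance numberField_adjoin_simple {Ω : Type*} [Field Ω] [CharZero Ω]
    [IsAlgClosure ℚ Ω] (x : Ω) : NumberField ℚ⟮x⟯ where
  to_charZero := inferInstance
  to_finiteDimensional := by
    have : Algebra.IsAlgebraic ℚ Ω := IsAlgClosure.isAlgebraic
    have : FiniteDimensional ℚ ℚ⟮x⟯ :=
      adjoin.finiteDimensional (Algebra.IsIntegral.isIntegral (R := ℚ) x)
    convert this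

/-- A set `A` of algebraic numbers has the Northcott property if for every bound `X` it contains
only finitely many elements of absolute multiplicative Weil height at most `X`. -/
def HasNorthcottProperty {Ω : Type*} [Field Ω] [CharZero Ω] (A : Set Ω) : Prop :=
  Northcott fun x : A ↦ NumberField.absMulHeight₁ (x : Ω)

/-!
The field `K(α₀, α₁, …)` is the union of the tower `F 0 ≤ F 1 ≤ …` with
`F n = K(α₀, …, αₙ₋₁)`. For `n` large, the prime `p = p n` is unramified in `K` and in all
`ℚ(α j)` with `j < n`. Inertia groups above `p` in a Galois closure therefore fix these fields,
hence also `F n`, so `p` is unramified in `F n` (`NumberField.ramificationIdx_under_iSup_eq_one`).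
Consequently, for a place `v` above `p`, the value group of `F n` is generated by `v p`
(`NumberField.FinitePlace.exists_apply_algebraMap_eq_zpow`), whereas every root `π` of the
`p`-Eisenstein polynomial `D n` of degree `d` satisfies `v π ^ d = v p`
(`AbsoluteValue.pow_natDegree_eq_of_isEisensteinAt`).

Let `x ∈ F (n + 1)` be outside `F n` and let `σ x ≠ x` be a conjugate of `x` over `F n`. If `x` is
integral at `v`, write `x` as a polynomial in `π = αₙ` of degree less than `d` over `F n`. Its terms
have distinct absolute values, so all of them are integral, and those of positive degree are at most
`v p ^ (1 / d)`. Hence `x` and `σ x` are both that close to the constant term. If `x` is not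
integral at `v`, argue with `x⁻¹`. This gives
`v (x - σ x) ^ d ≤ v p * (max (v x) 1 * max (v (σ x)) 1) ^ d` for all `v` above `p`
(`AbsoluteValue.apply_sub_pow_le_of_totallyRamified`), and the product formula for `x - σ x` yields
`p ^ (1 / d) ≤ 2 * H(x) ^ 2` (`NumberField.rpow_le_absMulHeight₁_of_mem_sup_adjoin`).

As `p n ^ (1 / d n) → ∞`, for every bound `B` there is `n₀` such that all elements of the union of
height at most `B` lie in `F n₀`, and number fields have the Northcott property. To compare the
absolute height, which is defined through `ℚ(x)`, with heights in larger number fields, the height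
is shown to be compatible with field extensions (`NumberField.mulHeight₁_algebraMap`).
-/

/-! ### Invariance of the height under field extensions -/

namespace NumberField

open Height

theorem InfinitePlace.prod_pow_mult_eq_prod_embeddings {K M : Type*} [Field K] [NumberField K]
    [CommMonoid M] (g : InfinitePlace K → M) :
    ∏ v, g v ^ v.mult = ∏ φ : K →+* ℂ, g (.mk φ) := by
  classical
  rw [← Finset.prod_fiberwise Finset.univ InfinitePlace.mk]
  refine Finset.prod_congr rfl fun v _ ↦ ?_
  rw [← InfinitePlace.card_filter_mk_eq v]
  exact (Finset.prod_eq_pow_card fun φ hφ ↦ by rw [(Finset.mem_filter.mp hφ).2]).symm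

variable {k N : Type*} [Field k] [NumberField k] [Field N] [NumberField N]

section Algebra

variable [Algebra k N]

/-- Every complex embedding of `k` has exactly `[N : k]` extensions to `N`. -/
theorem prod_embeddings_comp_algebraMap {M : Type*} [CommMonoid M] (g : (k →+* ℂ) → M) :
    ∏ φ : N →+* ℂ, g (φ.comp (algebraMap k N)) = (∏ ψ, g ψ) ^ Module.finrank k N := by
  classical
  rw [← Finset.prod_fiberwise Finset.univ (fun φ : N →+* ℂ ↦ φ.comp (algebraMap k N)),
    ← Finset.prod_pow]
  refine Finset.prod_congr rfl fun ψ _ ↦ ?_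
  let := ψ.toAlgebra
  have hcard : (Finset.univ.filter fun φ : N →+* ℂ ↦ φ.comp (algebraMap k N) = ψ).card =
      Module.finrank k N := by
    rw [← AlgHom.card k N ℂ, ← Fintype.card_subtype]
    exact Fintype.card_congr
      { toFun φ := { φ.1 with commutes' := fun x ↦ RingHom.congr_fun φ.2 x }
        invFun φ := ⟨φ.toRingHom, RingHom.ext φ.commutes⟩
        left_inv _ := rfl
        right_inv _ := rfl }
  rw [← hcard]
  exact Finset.prod_eq_pow_card fun φ hφ ↦ by rw [(Finset.mem_filter.mp hφ).2]

theorem InfinitePlace.prod_comap_pow_mult {M : Type*} [CommMonoid M] (g : InfinitePlace k → M) :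
    ∏ w : InfinitePlace N, g (w.comap (algebraMap k N)) ^ w.mult =
      (∏ v, g v ^ v.mult) ^ Module.finrank k N := by
  rw [prod_pow_mult_eq_prod_embeddings (fun w : InfinitePlace N ↦ g (w.comap (algebraMap k N))),
    prod_pow_mult_eq_prod_embeddings, ← prod_embeddings_comp_algebraMap]
  rfl

/-- The finite part of the height of an integral tuple is the inverse norm of the ideal it
generates, and the norm of an ideal extended to `N` is the `[N : k]`-th power of its norm. -/
theorem finprod_finitePlace_iSup_algebraMap {ι : Type*} [Finite ι] {y : ι → 𝓞 k} (hy : y ≠ 0) :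
    ∏ᶠ w : FinitePlace N, ⨆ i, w (algebraMap (𝓞 k) (𝓞 N) (y i) : 𝓞 N) =
      (∏ᶠ v : FinitePlace k, ⨆ i, v (y i)) ^ Module.finrank k N := by
  have hinj := FaithfulSMul.algebraMap_injective (𝓞 k) (𝓞 N)
  have hy' : (fun i ↦ algebraMap (𝓞 k) (𝓞 N) (y i)) ≠ 0 := by
    obtain ⟨i, hi⟩ := Function.ne_iff.mp hy
    exact Function.ne_iff.mpr ⟨i, (map_ne_zero_iff _ hinj).mpr hi⟩
  have h₁ := absNorm_mul_finprod_finitePlace_eq_one hy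
  have h₂ := absNorm_mul_finprod_finitePlace_eq_one hy'
  have hspan : Ideal.span (Set.range fun i ↦ algebraMap (𝓞 k) (𝓞 N) (y i)) =
      (Ideal.span (Set.range y)).map (algebraMap (𝓞 k) (𝓞 N)) := by
    rw [Ideal.map_span, ← Set.range_comp]; rfl
  rw [hspan, Ideal.absNorm_algebraMap, ← IsFractionRing.finrank_eq (𝓞 k) k (𝓞 N) N,
    Nat.cast_pow] at h₂
  refine mul_left_cancel₀ (left_ne_zero_of_mul (h₂.trans_ne one_ne_zero)) ?_
  rw [h₂, ← mul_pow, h₁, one_pow]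

theorem mulHeight₁_algebraMap (x : k) :
    mulHeight₁ (algebraMap k N x) = mulHeight₁ x ^ Module.finrank k N := by
  obtain ⟨n, hn, a, hx, -⟩ := exists_nat_ne_zero_exists_integer_mul_eq_and_absNorm_span_eq_pow x
  -- The heights of `x = a / n` and of its image are those of the integral tuple `(a, n)`.
  let y : Fin 2 → 𝓞 k := ![a, n]
  have hn' : (n : k) ≠ 0 := mod_cast hn
  have hy : y ≠ 0 := Function.ne_iff.mpr ⟨1, by simpa [y] using hn⟩
  have hyk : (fun i ↦ (y i : k)) ≠ 0 := Function.ne_iff.mpr ⟨1, by simpa [y] using hn⟩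
  have hyN : (fun i ↦ ((algebraMap (𝓞 k) (𝓞 N) (y i) : 𝓞 N) : N)) ≠ 0 :=
    Function.ne_iff.mpr ⟨1, by simpa [y] using hn⟩
  have hxk : x = (y 0 : k) / (y 1 : k) := by
    rw [eq_div_iff (by simpa [y] using hn), mul_comm]; simpa [y] using hx
  have hk : mulHeight₁ x = mulHeight (fun i ↦ (y i : k)) := by
    rw [hxk, mulHeight₁_div_eq_mulHeight]
    congr 1; ext i; fin_cases i <;> rfl
  have hN : mulHeight₁ (algebraMap k N x) =
      mulHeight (fun i ↦ ((algebraMap (𝓞 k) (𝓞 N) (y i) : 𝓞 N) : N)) := by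
    rw [hxk, map_div₀, mulHeight₁_div_eq_mulHeight]
    congr 1; ext i; fin_cases i <;> rfl
  rw [hk, hN, mulHeight_eq hyk, mulHeight_eq hyN, mul_pow, finprod_finitePlace_iSup_algebraMap hy,
    ← InfinitePlace.prod_comap_pow_mult (N := N)]
  rfl

end Algebra

/-- The height of the image of `x` under an embedding `φ : k →+* N` does not depend on `φ`. -/
theorem mulHeight₁_map_pow_finrank (φ : k →+* N) (x : k) :
    mulHeight₁ (φ x) ^ Module.finrank ℚ k = mulHeight₁ x ^ Module.finrank ℚ N := by
  let := φ.toAlgebra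
  have : IsScalarTower ℚ k N := .of_algebraMap_eq' (Subsingleton.elim _ _)
  rw [← Module.finrank_mul_finrank ℚ k N, mul_comm, pow_mul, ← mulHeight₁_algebraMap]
  rfl

/-- The absolute height computed in any number field into which `ℚ(x)` embeds. -/
theorem absMulHeight₁_pow_finrank {Ω : Type*} [Field Ω] [CharZero Ω] {x : Ω} (hx : IsIntegral ℚ x)
    (φ : ℚ⟮x⟯ →+* N) :
    absMulHeight₁ x ^ Module.finrank ℚ N = mulHeight₁ (φ (AdjoinSimple.gen ℚ x)) := by
  have : FiniteDimensional ℚ ℚ⟮x⟯ := adjoin.finiteDimensional hx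
  have : NumberField ℚ⟮x⟯ := {}
  have hd : Module.finrank ℚ ℚ⟮x⟯ ≠ 0 := Module.finrank_pos.ne'
  have h0 : (0 : ℝ) ≤ mulHeight₁ (φ (AdjoinSimple.gen ℚ x)) := (mulHeight₁_pos _).le
  rw [absMulHeight₁, dif_pos hx, ← Real.rpow_mul_natCast (mulHeight₁_pos _).le, mul_comm,
    Real.rpow_mul (mulHeight₁_pos _).le, Real.rpow_natCast, ← mulHeight₁_map_pow_finrank φ,
    Real.pow_rpow_inv_natCast h0 hd]

theorem absMulHeight₁_nonneg {Ω : Type*} [Field Ω] [CharZero Ω] (x : Ω) :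
    0 ≤ absMulHeight₁ x := by
  rw [absMulHeight₁]
  by_cases hx : IsIntegral ℚ x
  · have : FiniteDimensional ℚ ℚ⟮x⟯ := adjoin.finiteDimensional hx
    have : NumberField ℚ⟮x⟯ := {}
    rw [dif_pos hx]
    exact Real.rpow_nonneg (mulHeight₁_pos _).le _
  · rw [dif_neg hx]
    exact zero_le_one

end NumberField

/-! ### Total ramification at a nonarchimedean absolute value -/

namespace AbsoluteValue

variable {k L : Type*} [Field k] [Field L] [Algebra k L] {v : AbsoluteValue L ℝ}

section Eisenstein

theorem apply_intCast_eq_one_of_not_dvd (hv : IsNonarchimedean v) {p : ℕ} (hp : p.Prime)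
    (hvp : v p < 1) {c : ℤ} (hc : ¬ (p : ℤ) ∣ c) : v c = 1 := by
  have hint (n : ℤ) : v n ≤ 1 := hv.apply_intCast_le_one
  obtain ⟨a, b, hab⟩ := ((Nat.prime_iff_prime_int.mp hp).coprime_iff_not_dvd).mpr hc
  refine le_antisymm (hint c) (le_of_not_gt fun hlt ↦ ?_)
  have h := hv (a * p : L) (b * c : L)
  rw [show (a * p + b * c : L) = 1 by exact_mod_cast congrArg (Int.cast : ℤ → L) hab,
    map_one, map_mul, map_mul] at h
  have h₁ := mul_lt_one_of_nonneg_of_lt_one_right (hint a) (v.nonneg _) hvp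
  have h₂ := mul_lt_one_of_nonneg_of_lt_one_right (hint b) (v.nonneg _) hlt
  exact (h.trans_lt (max_lt h₁ h₂)).false

/-- A root of a `p`-Eisenstein polynomial of degree `d` is a `d`-th root of `p` as far as its
absolute value is concerned. -/
theorem pow_natDegree_eq_of_isEisensteinAt [CharZero L] (hv : IsNonarchimedean v) {p : ℕ}
    (hp : p.Prime) (hvp : v p < 1) {D : ℤ[X]} (hD : D.Monic)
    (heis : D.IsEisensteinAt (Ideal.span {(p : ℤ)})) {π : L} (hπ : aeval π D = 0) :
    v π ^ D.natDegree = v p := by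
  have hint (n : ℤ) : v n ≤ 1 := hv.apply_intCast_le_one
  have hp0 : 0 < v p := v.pos (mod_cast hp.ne_zero)
  have hneg (a : L) : v a = v (-a) := (v.map_neg a).symm
  set d := D.natDegree with hd
  have hd0 : 0 < d := natDegree_pos_of_monic_of_aeval_eq_zero hD hπ
  have hdvd {i : ℕ} (hi : i < d) : (p : ℤ) ∣ D.coeff i :=
    Ideal.mem_span_singleton.mp (heis.mem hi)
  have hcoeff {i : ℕ} (hi : i < d) : v (D.coeff i : L) ≤ v p := by
    obtain ⟨c, hc⟩ := hdvd hi
    rw [hc, Int.cast_mul, map_mul, Int.cast_natCast]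
    exact mul_le_of_le_one_right hp0.le (hint c)
  have hcoeff0 : v (D.coeff 0 : L) = v p := by
    obtain ⟨c, hc⟩ := hdvd hd0
    have hpc : ¬ (p : ℤ) ∣ c := by
      rintro ⟨e, rfl⟩
      refine heis.notMem ?_
      rw [Ideal.span_singleton_pow, Ideal.mem_span_singleton, hc]
      exact ⟨e, by ring⟩
    rw [hc, Int.cast_mul, map_mul, Int.cast_natCast, apply_intCast_eq_one_of_not_dvd hv hp hvp hpc,
      mul_one]
  have hsum : ∑ i ∈ Finset.range d, (D.coeff i : L) * π ^ i + π ^ d = 0 := by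
    rw [aeval_eq_sum_range, Finset.sum_range_succ, ← hd, hD.coeff_natDegree, one_smul] at hπ
    simpa only [zsmul_eq_mul] using hπ
  -- If `1 ≤ v π` then `π ^ d` dominates all other terms of the equation.
  have hπ1 : v π < 1 := by
    by_contra! h1
    have hpos : 0 < v π := one_pos.trans_le h1
    have hlt : v (∑ i ∈ Finset.range d, (D.coeff i : L) * π ^ i) < v (π ^ d) := by
      obtain ⟨j, hj, hle⟩ := hv.finset_image_add_of_nonempty
        (fun i ↦ (D.coeff i : L) * π ^ i) (Finset.nonempty_range_iff.mpr hd0.ne')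
      refine hle.trans_lt ?_
      have hj' := Finset.mem_range.mp hj
      rw [map_mul, map_pow, map_pow]
      calc v (D.coeff j : L) * v π ^ j ≤ v p * v π ^ d :=
            mul_le_mul (hcoeff hj') (pow_le_pow_right₀ h1 hj'.le) (by positivity) hp0.le
        _ < v π ^ d := mul_lt_of_lt_one_left (by positivity) hvp
    rw [eq_neg_of_add_eq_zero_left hsum, v.map_neg] at hlt
    exact hlt.false
  -- Hence the constant term dominates all other terms except `π ^ d`.
  have h := hv.apply_sum_eq_of_lt hneg (s := Finset.range d)
    (l := fun i ↦ (D.coeff i : L) * π ^ i) (k := 0) (Finset.mem_range.mpr hd0) fun j hj hj0 ↦ by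
      simp only [pow_zero, mul_one, hcoeff0, map_mul, map_pow]
      calc v (D.coeff j : L) * v π ^ j ≤ v p * v π ^ j := by
            gcongr
            exact hcoeff (Finset.mem_range.mp hj)
        _ < v p := mul_lt_of_lt_one_right hp0 (pow_lt_one₀ (v.nonneg _) hπ1 hj0)
  rw [eq_neg_of_add_eq_zero_left hsum, v.map_neg, map_pow] at h
  simpa [hcoeff0] using h

end Eisenstein

section TotallyRamified

/-! In this section the value group of `k` is generated by `P`, and `π` has absolute value
`P ^ (1 / d)`. -/

variable {P : ℝ} {d : ℕ} {π π' : L}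

theorem exists_apply_coeff_mul_pow_eq_zpow
    (hval : ∀ x : k, x ≠ 0 → ∃ m : ℤ, v (algebraMap k L x) = P ^ m)
    (hP0 : 0 < P) (hπ : v π ^ d = P) {a : k} (ha : a ≠ 0) (i : ℕ) :
    ∃ m : ℤ, v (algebraMap k L a * π ^ i) ^ d = P ^ (m * d + i) := by
  obtain ⟨m, hm⟩ := hval a ha
  refine ⟨m, ?_⟩
  rw [map_mul, map_pow, mul_pow, ← pow_mul, mul_comm i, pow_mul, hπ, hm, zpow_add₀ hP0.ne',
    zpow_mul, zpow_natCast, zpow_natCast]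

/-- The terms of a polynomial expression in `π` of degree less than `d` have distinct absolute
values, since these lie in distinct cosets of the value group of `k`. Hence the largest of them
is the absolute value of the sum. -/
theorem exists_apply_aeval_eq (hv : IsNonarchimedean v)
    (hval : ∀ x : k, x ≠ 0 → ∃ m : ℤ, v (algebraMap k L x) = P ^ m) (hP0 : 0 < P) (hP1 : P < 1)
    (hπ : v π ^ d = P) {f : k[X]} (hf : f.natDegree < d) :
    (∃ i < d, v (aeval π f) = v (algebraMap k L (f.coeff i) * π ^ i)) ∧
      ∀ i, v (algebraMap k L (f.coeff i) * π ^ i) ≤ v (aeval π f) := by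
  have hneg (a : L) : v a = v (-a) := (v.map_neg a).symm
  rcases eq_or_ne f 0 with rfl | hf0
  · exact ⟨⟨0, by lia, by simp⟩, by simp⟩
  obtain ⟨i, hi, hmax⟩ := f.support.exists_max_image
    (fun i ↦ v (algebraMap k L (f.coeff i) * π ^ i)) (nonempty_support_iff.mpr hf0)
  have hlt {j : ℕ} (hj : j ∈ f.support) : j < d := (le_natDegree_of_mem_supp j hj).trans_lt hf
  have hstrict : ∀ j ∈ f.support, j ≠ i →
      v (algebraMap k L (f.coeff j) * π ^ j) < v (algebraMap k L (f.coeff i) * π ^ i) := by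
    refine fun j hj hji ↦ (hmax j hj).lt_of_ne fun heq ↦ hji ?_
    obtain ⟨m, hm⟩ := exists_apply_coeff_mul_pow_eq_zpow hval hP0 hπ (mem_support_iff.mp hi) i
    obtain ⟨n, hn⟩ := exists_apply_coeff_mul_pow_eq_zpow hval hP0 hπ (mem_support_iff.mp hj) j
    have h : n * d + j = m * d + i :=
      zpow_right_injective₀ hP0 hP1.ne (by simp only [← hm, ← hn, heq])
    -- Since `i, j < d`, reducing modulo `d` shows that `i = j`.
    have h' := congrArg (· % (d : ℤ)) h
    simp only [Int.mul_add_emod_self_right] at h'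
    rw [Int.emod_eq_of_lt (by positivity) (mod_cast hlt hj),
      Int.emod_eq_of_lt (by positivity) (mod_cast hlt hi)] at h'
    exact_mod_cast h'
  have hsum : v (aeval π f) = v (algebraMap k L (f.coeff i) * π ^ i) := by
    rw [aeval_def, eval₂_eq_sum, Polynomial.sum]
    exact hv.apply_sum_eq_of_lt hneg hi hstrict
  refine ⟨⟨i, hlt hi, hsum⟩, fun j ↦ ?_⟩
  by_cases hj : j ∈ f.support
  · exact (hmax j hj).trans_eq hsum.symm
  · simp [notMem_support_iff.mp hj]

theorem apply_aeval_eq_apply_aeval (hv : IsNonarchimedean v)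
    (hval : ∀ x : k, x ≠ 0 → ∃ m : ℤ, v (algebraMap k L x) = P ^ m) (hP0 : 0 < P) (hP1 : P < 1)
    (hπ : v π ^ d = P) (hπ' : v π' ^ d = P) {f : k[X]} (hf : f.natDegree < d) :
    v (aeval π f) = v (aeval π' f) := by
  have h : v π = v π' := 
    (pow_left_inj₀ (v.nonneg _) (v.nonneg _) (by lia : d ≠ 0)).mp (hπ.trans hπ'.symm)
  obtain ⟨⟨i, -, hi⟩, hle⟩ := exists_apply_aeval_eq hv hval hP0 hP1 hπ hf
  obtain ⟨⟨j, -, hj⟩, hle'⟩ := exists_apply_aeval_eq hv hval hP0 hP1 hπ' hf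
  have hterm (i : ℕ) : v (algebraMap k L (f.coeff i) * π ^ i) =
      v (algebraMap k L (f.coeff i) * π' ^ i) := by simp only [map_mul, map_pow, h]
  exact le_antisymm (hi.trans_le ((hterm i).trans_le (hle' i)))
    (hj.trans_le ((hterm j).symm.trans_le (hle j)))

/-- An integral polynomial expression in `π` is congruent to its constant coefficient: a term of
absolute value at most `1` and of positive degree has absolute value at most `P ^ (1 / d)`. -/
theorem apply_aeval_sub_pow_le (hv : IsNonarchimedean v)
    (hval : ∀ x : k, x ≠ 0 → ∃ m : ℤ, v (algebraMap k L x) = P ^ m) (hP0 : 0 < P) (hP1 : P < 1)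
    (hπ : v π ^ d = P) {f : k[X]} (hf : f.natDegree < d) (h1 : v (aeval π f) ≤ 1) :
    v (aeval π f - algebraMap k L (f.coeff 0)) ^ d ≤ P := by
  have hg : (f - C (f.coeff 0)).natDegree < d := by rwa [natDegree_sub_C]
  obtain ⟨⟨i, hid, hi⟩, -⟩ := exists_apply_aeval_eq hv hval hP0 hP1 hπ hg
  have hle := (exists_apply_aeval_eq hv hval hP0 hP1 hπ hf).2 i
  rw [map_sub, aeval_C] at hi
  rw [hi]
  have hd : d ≠ 0 := by lia
  by_cases hzero : (f - C (f.coeff 0)).coeff i = 0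
  · simpa [hzero, hd] using hP0.le
  have hi0 : i ≠ 0 := by
    rintro rfl
    simp at hzero
  have hcoeff : (f - C (f.coeff 0)).coeff i = f.coeff i := by simp [coeff_C, hi0]
  rw [hcoeff] at hzero ⊢
  obtain ⟨m, hm⟩ := exists_apply_coeff_mul_pow_eq_zpow hval hP0 hπ hzero i
  have hle1 : P ^ (m * d + i) ≤ P ^ (0 : ℤ) := by
    rw [← hm, zpow_zero]
    exact pow_le_one₀ (v.nonneg _) (hle.trans h1)
  have hnonneg := (zpow_le_zpow_iff_right_of_lt_one₀ hP0 hP1).mp hle1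
  have hpos : (1 : ℤ) ≤ m * d + i := by
    have hne : m * d + i ≠ 0 := fun h0 ↦ by
      have hdvd : (d : ℤ) ∣ i := ⟨-m, by linear_combination h0⟩
      exact hid.not_ge (Nat.le_of_dvd (Nat.pos_of_ne_zero hi0) (Int.natCast_dvd_natCast.mp hdvd))
    lia
  rw [hm]
  calc P ^ (m * d + i : ℤ) ≤ P ^ (1 : ℤ) := (zpow_le_zpow_iff_right_of_lt_one₀ hP0 hP1).mpr hpos
    _ = P := zpow_one P

theorem apply_aeval_sub_aeval_pow_le (hv : IsNonarchimedean v)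
    (hval : ∀ x : k, x ≠ 0 → ∃ m : ℤ, v (algebraMap k L x) = P ^ m) (hP0 : 0 < P) (hP1 : P < 1)
    (hπ : v π ^ d = P) (hπ' : v π' ^ d = P) {f : k[X]} (hf : f.natDegree < d)
    (h1 : v (aeval π f) ≤ 1) : v (aeval π f - aeval π' f) ^ d ≤ P := by
  have h1' := (apply_aeval_eq_apply_aeval hv hval hP0 hP1 hπ hπ' hf).symm.trans_le h1
  have h := hv (aeval π f - algebraMap k L (f.coeff 0))
    (-(aeval π' f - algebraMap k L (f.coeff 0)))
  rw [v.map_neg, ← sub_eq_add_neg, sub_sub_sub_cancel_right] at h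
  rcases le_max_iff.mp h with h | h
  · exact (pow_le_pow_left₀ (v.nonneg _) h d).trans
      (apply_aeval_sub_pow_le hv hval hP0 hP1 hπ hf h1)
  · exact (pow_le_pow_left₀ (v.nonneg _) h d).trans
      (apply_aeval_sub_pow_le hv hval hP0 hP1 hπ' hf h1')

/-- Two conjugates `x`, `x'` in a totally ramified extension are close to each other. If they are
not integral, then their inverses are, and `x - x' = -(x⁻¹ - x'⁻¹) * x * x'`. -/
theorem apply_sub_pow_le_of_totallyRamified (hv : IsNonarchimedean v)
    (hval : ∀ x : k, x ≠ 0 → ∃ m : ℤ, v (algebraMap k L x) = P ^ m) (hP0 : 0 < P) (hP1 : P < 1)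
    (hπ : v π ^ d = P) (hπ' : v π' ^ d = P) {f g : k[X]} (hf : f.natDegree < d)
    (hg : g.natDegree < d) {x x' : L} (hx : x ≠ 0) (hx' : x' ≠ 0) (hfx : aeval π f = x)
    (hfx' : aeval π' f = x') (hgx : aeval π g = x⁻¹) (hgx' : aeval π' g = x'⁻¹) :
    v (x - x') ^ d ≤ P * (max (v x) 1 * max (v x') 1) ^ d := by
  rcases le_total (v x) 1 with h1 | h1
  · have h := apply_aeval_sub_aeval_pow_le hv hval hP0 hP1 hπ hπ' hf (hfx ▸ h1)
    rw [hfx, hfx'] at h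
    exact h.trans (le_mul_of_one_le_right hP0.le
      (one_le_pow₀ (one_le_mul_of_one_le_of_one_le (le_max_right _ _) (le_max_right _ _))))
  · have h := apply_aeval_sub_aeval_pow_le hv hval hP0 hP1 hπ hπ' hg
      (by rw [hgx, map_inv₀]; exact inv_le_one_of_one_le₀ h1)
    rw [hgx, hgx'] at h
    have hfac : x - x' = -(x⁻¹ - x'⁻¹) * (x * x') := by field_simp; ring
    rw [hfac, map_mul, v.map_neg, map_mul, mul_pow]
    gcongr
    · exact le_max_left _ _
    · exact le_max_left _ _

end TotallyRamified

end AbsoluteValue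

/-! ### A lower bound for the height of a generator of a totally ramified extension -/

namespace NumberField

open Height

variable {N : Type*} [Field N] [NumberField N]

theorem FinitePlace.isNonarchimedean (v : FinitePlace N) : IsNonarchimedean v.val :=
  FinitePlace.add_le v

theorem FinitePlace.apply_natCast_le_one (v : FinitePlace N) (n : ℕ) : v (n : N) ≤ 1 :=
  v.isNonarchimedean.apply_natCast_le_one (f := v.val)

theorem FinitePlace.hasFiniteMulSupport_max_one {x : N} (hx : x ≠ 0) :
    Function.HasFiniteMulSupport fun v : FinitePlace N ↦ max (v x) 1 :=
  (FinitePlace.hasFiniteMulSupport hx).subset fun v hv h ↦ hv (by simp_all)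

theorem FinitePlace.finprod_apply_natCast {p : ℕ} (hp : p ≠ 0) :
    ∏ᶠ v : FinitePlace N, v (p : N) = ((p : ℝ) ^ Module.finrank ℚ N)⁻¹ := by
  rw [FinitePlace.prod_eq_inv_abs_norm (mod_cast hp), ← map_natCast (algebraMap ℚ N),
    Algebra.norm_algebraMap]
  simp

theorem InfinitePlace.prod_apply_sub_le (x y : N) :
    ∏ v : InfinitePlace N, v (x - y) ^ v.mult ≤
      2 ^ Module.finrank ℚ N * ((∏ v : InfinitePlace N, max (v x) 1 ^ v.mult) *
        ∏ v : InfinitePlace N, max (v y) 1 ^ v.mult) := by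
  rw [← InfinitePlace.sum_mult_eq, ← Finset.prod_pow_eq_pow_sum, ← Finset.prod_mul_distrib,
    ← Finset.prod_mul_distrib]
  refine Finset.prod_le_prod (fun _ _ ↦ pow_nonneg (apply_nonneg _ _) _) fun v _ ↦ ?_
  rw [← mul_pow, ← mul_pow]
  refine pow_le_pow_left₀ (apply_nonneg _ _) ?_ _
  have hx := le_max_left (v x) 1
  have hx1 := le_max_right (v x) 1
  have hy := le_max_left (v y) 1
  have hy1 := le_max_right (v y) 1
  calc v (x - y) ≤ v x + v y := by
        simpa only [InfinitePlace.coe_apply] using v.val.sub_le_add x y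
    _ ≤ 2 * (max (v x) 1 * max (v y) 1) := by nlinarith

/-- If `x` and `y` are close at all places above `p`, then the product formula for `x - y` forces
their heights to be large. -/
theorem pow_finrank_le_of_apply_sub_le {p d : ℕ} (hp : p ≠ 0) {x y : N} (hx : x ≠ 0) (hy : y ≠ 0)
    (hxy : x ≠ y)
    (h : ∀ v : FinitePlace N, v (p : N) < 1 →
      v (x - y) ^ d ≤ v (p : N) * (max (v x) 1 * max (v y) 1) ^ d) :
    (p : ℝ) ^ Module.finrank ℚ N ≤
      (2 ^ Module.finrank ℚ N * (mulHeight₁ x * mulHeight₁ y)) ^ d := by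
  set n := Module.finrank ℚ N
  have hsub : x - y ≠ 0 := sub_ne_zero.mpr hxy
  have hp' : (p : N) ≠ 0 := mod_cast hp
  have hloc (v : FinitePlace N) : v (x - y) ^ d ≤ v (p : N) * (max (v x) 1 * max (v y) 1) ^ d := by
    rcases (v.apply_natCast_le_one p).lt_or_eq with hlt | heq
    · exact h v hlt
    rw [heq, one_mul]
    refine pow_le_pow_left₀ (apply_nonneg _ _) ?_ _
    have hle := v.isNonarchimedean x (-y)
    rw [← sub_eq_add_neg, v.val.map_neg] at hle
    refine hle.trans (max_le ?_ ?_)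
    · exact (le_max_left _ 1).trans (le_mul_of_one_le_right (by positivity) (le_max_right _ _))
    · exact (le_max_left _ 1).trans (le_mul_of_one_le_left (by positivity) (le_max_right _ _))
  have hfin : (∏ᶠ v : FinitePlace N, v (x - y)) ^ d ≤ ((p : ℝ) ^ n)⁻¹ *
      ((∏ᶠ v : FinitePlace N, max (v x) 1) * ∏ᶠ v : FinitePlace N, max (v y) 1) ^ d := by
    have hX := FinitePlace.hasFiniteMulSupport_max_one hx
    have hY := FinitePlace.hasFiniteMulSupport_max_one hy
    have hXY : Function.HasFiniteMulSupport fun v : FinitePlace N ↦ max (v x) 1 * max (v y) 1 :=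
      hX.fun_mul hY
    rw [← FinitePlace.finprod_apply_natCast hp, ← finprod_mul_distrib hX hY,
      finprod_pow (FinitePlace.hasFiniteMulSupport hsub), finprod_pow hXY,
      ← finprod_mul_distrib (FinitePlace.hasFiniteMulSupport hp') (hXY.fun_pow d)]
    exact finprod_le_finprod ((FinitePlace.hasFiniteMulSupport hsub).fun_pow d)
      (fun v ↦ pow_nonneg (apply_nonneg _ _) _)
      ((FinitePlace.hasFiniteMulSupport hp').fun_mul (hXY.fun_pow d)) hloc
  have hinf := pow_le_pow_left₀
    (Finset.prod_nonneg fun v _ ↦ pow_nonneg (apply_nonneg _ _) _)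
    (InfinitePlace.prod_apply_sub_le x y) d
  have hone : (1 : ℝ) ≤ ((p : ℝ) ^ n)⁻¹ *
      (2 ^ n * (mulHeight₁ x * mulHeight₁ y)) ^ d := by
    have hprod := mul_le_mul hinf hfin (pow_nonneg (finprod_nonneg fun v ↦ apply_nonneg _ _) _)
      (by positivity)
    rw [← mul_pow, prod_abs_eq_one hsub, one_pow] at hprod
    refine hprod.trans_eq ?_
    rw [mulHeight₁_eq, mulHeight₁_eq]
    ring
  have hpos : (0 : ℝ) < (p : ℝ) ^ n := by positivity
  rwa [inv_mul_eq_div, le_div_iff₀ hpos, one_mul] at hone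

theorem exists_aeval_eq_of_mem_adjoin_simple {k L : Type*} [Field k] [Field L] [CharZero L]
    [Algebra k L] {D : ℤ[X]} (hD : D.Monic) {π : L} (hπ : aeval π D = 0) {x : L}
    (hx : x ∈ k⟮π⟯) :
    ∃ f : k[X], f.natDegree < D.natDegree ∧ aeval π f = x := by
  have hDk : (D.map (Int.castRingHom k)).Monic := hD.map _
  have hroot : aeval π (D.map (Int.castRingHom k)) = 0 := by
    rw [← hπ]
    exact aeval_map_algebraMap k π D
  have hint : IsIntegral k π := ⟨_, hDk, hroot⟩
  rw [← mem_toSubalgebra, adjoin_simple_toSubalgebra_of_isAlgebraic hint.isAlgebraic,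
    Algebra.adjoin_singleton_eq_range_aeval] at hx
  obtain ⟨g, rfl⟩ := hx
  have hd := natDegree_pos_of_monic_of_aeval_eq_zero hD hπ
  refine ⟨g %ₘ D.map (Int.castRingHom k), ?_, ?_⟩
  · rw [← hD.natDegree_map (Int.castRingHom k)] at hd ⊢
    exact natDegree_modByMonic_lt g hDk fun h ↦ by simp [h] at hd
  · exact aeval_modByMonic_eq_self_of_root hroot

/-- If `p` is unramified in `k`, which is what `hval` says, then the extension of `k` generated by a
root of a `p`-Eisenstein polynomial consists of elements of `k` and of elements whose height is
bounded below in terms of `p` and of the degree of the polynomial. -/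
theorem pow_finrank_le_of_mem_adjoin {k : Type*} [Field k] [Algebra k N] [IsGalois k N]
    [FiniteDimensional k N] {p : ℕ} (hp : p.Prime)
    (hval : ∀ v : FinitePlace N, v (p : N) < 1 → ∀ a : k, a ≠ 0 →
      ∃ m : ℤ, v (algebraMap k N a) = v (p : N) ^ m)
    {D : ℤ[X]} (hD : D.Monic) (heis : D.IsEisensteinAt (Ideal.span {(p : ℤ)})) {π : N}
    (hπ : aeval π D = 0) {x : N} (hx : x ∈ k⟮π⟯) (hxk : x ∉ (algebraMap k N).range) :
    (p : ℝ) ^ Module.finrank ℚ N ≤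
      (2 ^ Module.finrank ℚ N * (mulHeight₁ x * mulHeight₁ x)) ^ D.natDegree := by
  have hx0 : x ≠ 0 := by rintro rfl; exact hxk (zero_mem _)
  obtain ⟨σ, hσ⟩ : ∃ σ : Gal(N/k), σ x ≠ x := by
    by_contra! h
    exact hxk (IntermediateField.mem_bot.mp ((IsGalois.mem_bot_iff_fixed x).mpr h))
  have hσπ : aeval (σ π) D = 0 := by
    have h := aeval_algHom_apply ((σ : N →ₐ[k] N).restrictScalars ℤ) π D
    rw [hπ, map_zero] at h
    exact h
  have hσx : mulHeight₁ (σ x) = mulHeight₁ x :=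
    (pow_left_inj₀ (mulHeight₁_pos _).le (mulHeight₁_pos _).le
      (Module.finrank_pos (R := ℚ) (M := N)).ne').mp (mulHeight₁_map_pow_finrank (σ : N →+* N) x)
  have hσx0 : σ x ≠ 0 := (map_ne_zero_iff σ σ.injective).mpr hx0
  have key := pow_finrank_le_of_apply_sub_le (d := D.natDegree) hp.ne_zero hx0 hσx0 hσ.symm
    fun v hv ↦ ?_
  · rwa [hσx] at key
  obtain ⟨f, hf, hfx⟩ := exists_aeval_eq_of_mem_adjoin_simple hD hπ hx
  obtain ⟨g, hg, hgx⟩ := exists_aeval_eq_of_mem_adjoin_simple hD hπ (inv_mem hx)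
  have hmap (f : k[X]) : aeval (σ π) f = σ (aeval π f) := aeval_algHom_apply (σ : N →ₐ[k] N) π f
  exact AbsoluteValue.apply_sub_pow_le_of_totallyRamified v.isNonarchimedean (hval v hv)
    (FinitePlace.pos_iff.mpr (mod_cast hp.ne_zero)) hv
    (AbsoluteValue.pow_natDegree_eq_of_isEisensteinAt v.isNonarchimedean hp hv hD heis hπ)
    (AbsoluteValue.pow_natDegree_eq_of_isEisensteinAt v.isNonarchimedean hp hv hD heis hσπ)
    hf hg hx0 hσx0 hfx (by rw [hmap, hfx]) hgx (by rw [hmap, hgx, map_inv₀])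

end NumberField

/-! ### Unramified primes, inertia groups and value groups -/

namespace NumberField

open IsDedekindDomain

theorem ramificationIdx_under_eq_one_of_not_dvd_discr {k N : Type*} [Field k]
    [NumberField k] [Field N] [Algebra k N] {p : ℕ} (hp : p.Prime) (h : ¬ (p : ℤ) ∣ discr k)
    {P : Ideal (𝓞 N)} [P.IsPrime] (hP : (p : 𝓞 N) ∈ P) :
    (P.under (𝓞 k)).ramificationIdx ℤ = 1 := by
  have := (not_dvd_discr_iff_forall_mem k (𝓞 k) (Nat.prime_iff_prime_int.mp hp)).mp h
    (P.under (𝓞 k)) inferInstance (by simpa [Ideal.mem_comap] using hP)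
  exact Ideal.ramificationIdx_eq_one_of_isUnramifiedAt

variable {k N : Type*} [Field k] [NumberField k] [Field N] [NumberField N] [Algebra k N]

theorem restrictScalars_mem_inertia {P : Ideal (𝓞 N)} (σ : Gal(N/k)) :
    σ.restrictScalars ℚ ∈ P.inertia Gal(N/ℚ) ↔ σ ∈ P.inertia Gal(N/k) :=
  Iff.rfl

theorem card_inertia_eq_ramificationIdx [IsGalois k N] (P : Ideal (𝓞 N)) [P.IsPrime] :
    Nat.card (P.inertia Gal(N/k)) = P.ramificationIdx (𝓞 k) := by
  rw [Ideal.card_inertia_eq_ramificationIdxIn (P.under (𝓞 k)) P,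
    Ideal.ramificationIdxIn_eq_ramificationIdx (P.under (𝓞 k)) P Gal(N/k)]

theorem card_inertia_rat_eq_ramificationIdx [IsGalois ℚ N] (P : Ideal (𝓞 N)) [P.IsPrime] :
    Nat.card (P.inertia Gal(N/ℚ)) = P.ramificationIdx ℤ := by
  rw [Ideal.card_inertia_eq_ramificationIdxIn (P.under ℤ) P,
    Ideal.ramificationIdxIn_eq_ramificationIdx (P.under ℤ) P Gal(N/ℚ)]

/-- The prime of `k` below `P` is unramified over `ℚ` if and only if the inertia group of `P`
fixes `k`. In particular the subfields of `N` that are unramified below `P` are closed under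
composita. -/
theorem ramificationIdx_under_eq_one_iff [IsGalois ℚ N] (P : Ideal (𝓞 N)) [P.IsPrime] :
    (P.under (𝓞 k)).ramificationIdx ℤ = 1 ↔
      ∀ σ ∈ P.inertia Gal(N/ℚ), ∀ x : k, σ (algebraMap k N x) = algebraMap k N x := by
  have : IsGalois k N := IsGalois.tower_top_of_isGalois ℚ k N
  have htower := Ideal.ramificationIdx_tower (R := ℤ) (P.under (𝓞 k)) P
  rw [← card_inertia_eq_ramificationIdx (k := k), ← card_inertia_rat_eq_ramificationIdx] at htower
  let f : P.inertia Gal(N/k) → P.inertia Gal(N/ℚ) :=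
    fun σ ↦ ⟨σ.1.restrictScalars ℚ, (restrictScalars_mem_inertia σ.1).mpr σ.2⟩
  have hf : Function.Injective f := fun σ τ h ↦
    Subtype.ext (AlgEquiv.restrictScalars_injective ℚ (congrArg Subtype.val h))
  have hpos : Nat.card (P.inertia Gal(N/k)) ≠ 0 := Nat.card_pos.ne'
  constructor
  · intro h σ hσ x
    rw [h, one_mul] at htower
    obtain ⟨τ, hτ⟩ := ((Nat.bijective_iff_injective_and_card f).mpr ⟨hf, htower.symm⟩).2 ⟨σ, hσ⟩
    have hτσ : τ.1.restrictScalars ℚ = σ := congrArg Subtype.val hτ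
    rw [← hτσ]
    exact τ.1.commutes x
  · intro h
    have hsurj : Function.Surjective f := fun σ ↦ by
      let τ : Gal(N/k) := { σ.1 with commutes' := h σ.1 σ.2 }
      exact ⟨⟨τ, (restrictScalars_mem_inertia τ).mp σ.2⟩, rfl⟩
    rw [← Nat.card_eq_of_bijective f ⟨hf, hsurj⟩] at htower
    exact (Nat.eq_of_mul_eq_mul_right (Nat.pos_of_ne_zero hpos)
      (by rw [one_mul]; exact htower)).symm

theorem FinitePlace.apply_lt_one_iff_mem (v : FinitePlace N) (x : 𝓞 N) :
    v (x : N) < 1 ↔ x ∈ v.maximalIdeal.asIdeal := by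
  rw [← FinitePlace.norm_lt_one_iff_mem N, ← v.norm_embedding_eq]

/-- If `p` is unramified in `k`, then the value group of `k` at a place above `p` is generated by
the absolute value of `p`. -/
theorem FinitePlace.exists_apply_algebraMap_eq_zpow {p : ℕ} (hp : p.Prime) (v : FinitePlace N)
    (hv : v (p : N) < 1) (h : (v.maximalIdeal.asIdeal.under (𝓞 k)).ramificationIdx ℤ = 1)
    {a : k} (ha : a ≠ 0) : ∃ m : ℤ, v (algebraMap k N a) = v (p : N) ^ m := by
  let w : HeightOneSpectrum (𝓞 N) := v.maximalIdeal
  have hint : Prime (p : ℤ) := Nat.prime_iff_prime_int.mp hp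
  have hpw : (p : 𝓞 N) ∈ w.asIdeal := (v.apply_lt_one_iff_mem p).mp hv
  have hq : w.asIdeal.under (𝓞 k) ≠ ⊥ := Ideal.IsIntegral.comap_ne_bot (R := 𝓞 k) w.ne_bot
  let q : HeightOneSpectrum (𝓞 k) := ⟨w.asIdeal.under (𝓞 k), inferInstance, hq⟩
  let u : HeightOneSpectrum ℤ := ⟨.span {(p : ℤ)},
    (Ideal.span_singleton_prime hint.ne_zero).mpr hint,
    by simpa using hp.ne_zero⟩
  have hwq : w.asIdeal.LiesOver q.asIdeal := ⟨rfl⟩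
  have hqu : q.asIdeal.LiesOver u.asIdeal :=
    (Ideal.liesOver_span_iff q.isPrime.ne_top hint).mpr (by
      simpa [q, Ideal.mem_comap] using hpw)
  have hqp : q.valuation k (p : k) = WithZero.exp (-1 : ℤ) := by
    have h₁ := HeightOneSpectrum.intValuation_liesOver u q (p : ℤ)
    rw [Ideal.ramificationIdx'_eq_ramificationIdx u.asIdeal q.asIdeal u.ne_bot, h, pow_one,
      u.intValuation_singleton hint.ne_zero rfl] at h₁
    rw [h₁, ← HeightOneSpectrum.valuation_of_algebraMap (K := k)]
    simp
  obtain ⟨m, hm⟩ : ∃ m : ℤ, q.valuation k a = q.valuation k (p : k) ^ m := by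
    have h0 : q.valuation k a ≠ 0 := (Valuation.ne_zero_iff _).mpr ha
    refine ⟨-(q.valuation k a).log, ?_⟩
    rw [hqp, ← WithZero.exp_zsmul]
    simp [WithZero.exp_log h0]
  refine ⟨m, ?_⟩
  have hwa : w.valuation N (algebraMap k N a) = w.valuation N (p : N) ^ m := by
    rw [← HeightOneSpectrum.valuation_liesOver N q w, hm, ← zpow_natCast, zpow_comm, zpow_natCast,
      HeightOneSpectrum.valuation_liesOver N q w, map_natCast]
  have hv' (x : N) : v x = HeightOneSpectrum.adicAbv N w x := by
    rw [← v.norm_embedding_eq, FinitePlace.norm_embedding]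
  rw [hv', hv', HeightOneSpectrum.adicAbv_def, HeightOneSpectrum.adicAbv_def, hwa, map_zpow₀]
  simp

end NumberField

/-! ### Composita of number fields inside an algebraic closure of `ℚ` -/

namespace NumberField

open Height

/-- A compositum of number fields in which `p` is unramified is fixed by all inertia groups
above `p`. -/
theorem ramificationIdx_under_iSup_eq_one {Ω : Type*} [Field Ω] [CharZero Ω] {ι : Type*}
    (E : ι → IntermediateField ℚ Ω) [∀ i, NumberField (E i)] {p : ℕ} (hp : p.Prime)
    (hE : ∀ i, ¬ (p : ℤ) ∣ discr (E i)) {N : IntermediateField ℚ Ω} [NumberField N] [IsGalois ℚ N] [NumberField ↥(⨆ i, E i)]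
    [Algebra ↥(⨆ i, E i) N] (halg : ∀ x : ↥(⨆ i, E i), (algebraMap _ N x : Ω) = x)
    {P : Ideal (𝓞 N)} [P.IsPrime] (hP : (p : 𝓞 N) ∈ P) :
    (P.under (𝓞 ↥(⨆ i, E i))).ramificationIdx ℤ = 1 := by
  refine (ramificationIdx_under_eq_one_iff P).mpr fun σ hσ x ↦ ?_
  let W : IntermediateField ℚ Ω := lift (fixedField (P.inertia Gal(N/ℚ)))
  have hle : ⨆ i, E i ≤ N := fun y hy ↦ by
    simpa only [halg] using (algebraMap ↥(⨆ i, E i) N ⟨y, hy⟩).2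
  have hW : ⨆ i, E i ≤ W := by
    refine iSup_le fun i y hy ↦ ?_
    have hi : E i ≤ N := (le_iSup E i).trans hle
    let : Algebra (E i) N := (inclusion hi).toRingHom.toAlgebra
    refine (IntermediateField.mem_lift (⟨y, hi hy⟩ : N)).mpr
      ((mem_fixedField_iff _ _).mpr fun τ hτ ↦ ?_)
    exact (ramificationIdx_under_eq_one_iff P).mp
      (ramificationIdx_under_eq_one_of_not_dvd_discr hp (hE i) hP) τ hτ ⟨y, hy⟩
  have hx : algebraMap _ N x ∈ fixedField (P.inertia Gal(N/ℚ)) :=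
    (IntermediateField.mem_lift _).mp ((halg x).symm ▸ hW x.2)
  exact (mem_fixedField_iff _ _).mp hx σ hσ

variable {Ω : Type*} [Field Ω] [CharZero Ω] [IsAlgClosure ℚ Ω]

theorem exists_isGalois_ge (M : IntermediateField ℚ Ω) [FiniteDimensional ℚ M] :
    ∃ N : IntermediateField ℚ Ω, M ≤ N ∧ NumberField N ∧ IsGalois ℚ N := by
  have : Normal ℚ Ω := IsAlgClosure.normal ℚ Ω
  have hn := normalClosure.normal ℚ M Ω
  have hs : Algebra.IsSeparable ℚ (normalClosure ℚ M Ω) := inferInstance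
  exact ⟨normalClosure ℚ M Ω, M.le_normalClosure, {}, { to_isSeparable := hs, to_normal := hn }⟩

/-- The height bound that makes the tower of composita Northcott: adjoining a root of a
`p`-Eisenstein polynomial to a compositum of number fields in which `p` is unramified adds no
elements of small height. -/
theorem rpow_le_absMulHeight₁_of_mem_sup_adjoin {ι : Type*} (E : ι → IntermediateField ℚ Ω)
    [∀ i, NumberField (E i)] [FiniteDimensional ℚ ↥(⨆ i, E i)] {p : ℕ} (hp : p.Prime)
    (hE : ∀ i, ¬ (p : ℤ) ∣ discr (E i)) {D : ℤ[X]} (hD : D.Monic)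
    (heis : D.IsEisensteinAt (Ideal.span {(p : ℤ)})) {α : Ω} (hα : aeval α D = 0) {x : Ω}
    (hx : x ∈ (⨆ i, E i) ⊔ ℚ⟮α⟯) (hxE : x ∉ ⨆ i, E i) :
    (p : ℝ) ^ (1 / (D.natDegree : ℝ)) ≤ 2 * absMulHeight₁ x ^ 2 := by
  have : Algebra.IsAlgebraic ℚ Ω := IsAlgClosure.isAlgebraic
  have hαint : IsIntegral ℚ α := Algebra.IsIntegral.isIntegral (R := ℚ) α
  have hxint : IsIntegral ℚ x := Algebra.IsIntegral.isIntegral (R := ℚ) x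
  have : FiniteDimensional ℚ ℚ⟮α⟯ := adjoin.finiteDimensional hαint
  set F := ⨆ i, E i
  have : NumberField F := {}
  obtain ⟨N, hN, _, _⟩ := exists_isGalois_ge (F ⊔ ℚ⟮α⟯)
  have hFN : F ≤ N := le_sup_left.trans hN
  have hαN : α ∈ N := hN ((le_sup_right : ℚ⟮α⟯ ≤ _) (mem_adjoin_simple_self ℚ α))
  let : Algebra F N := (inclusion hFN).toRingHom.toAlgebra
  have hgal : IsGalois F N := IsGalois.tower_top_of_isGalois ℚ F N
  have hd := natDegree_pos_of_monic_of_aeval_eq_zero hD hα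
  have hπ : aeval (⟨α, hαN⟩ : N) D = 0 :=
    Subtype.ext ((aeval_algHom_apply (N.val.restrictScalars ℤ) (⟨α, hαN⟩ : N) D).symm.trans hα)
  have hxπ : (⟨x, hN hx⟩ : N) ∈ F⟮(⟨α, hαN⟩ : N)⟯ := by
    let T : IntermediateField ℚ N := F⟮(⟨α, hαN⟩ : N)⟯.restrictScalars ℚ
    have hT : F ⊔ ℚ⟮α⟯ ≤ lift T := by
      refine sup_le (fun y hy ↦ ?_) (adjoin_simple_le_iff.mpr ?_)
      · exact (IntermediateField.mem_lift (⟨y, hFN hy⟩ : N)).mpr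
          (IntermediateField.algebraMap_mem F⟮(⟨α, hαN⟩ : N)⟯ ⟨y, hy⟩)
      · exact (IntermediateField.mem_lift (⟨α, hαN⟩ : N)).mpr
          (mem_adjoin_simple_self F (⟨α, hαN⟩ : N))
    exact (IntermediateField.mem_lift (⟨x, hN hx⟩ : N)).mp (hT hx)
  have hxF : (⟨x, hN hx⟩ : N) ∉ (algebraMap F N).range := by
    rintro ⟨y, hy⟩
    have hyx : (y : Ω) = x := congrArg Subtype.val hy
    exact hxE (hyx ▸ y.2)
  have key := pow_finrank_le_of_mem_adjoin hp (fun v hv a ha ↦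
    v.exists_apply_algebraMap_eq_zpow hp hv (ramificationIdx_under_iSup_eq_one E hp hE (fun _ ↦ rfl)
      ((v.apply_lt_one_iff_mem p).mp hv)) ha) hD heis hπ hxπ hxF
  have hxN : ℚ⟮x⟯ ≤ N := adjoin_simple_le_iff.mpr (hN hx)
  have hheight : mulHeight₁ (⟨x, hN hx⟩ : N) = absMulHeight₁ x ^ Module.finrank ℚ N :=
    (absMulHeight₁_pow_finrank hxint (inclusion hxN).toRingHom).symm
  have hH := absMulHeight₁_nonneg x
  rw [hheight, ← mul_pow, ← mul_pow, ← pow_mul, mul_comm (Module.finrank ℚ N), pow_mul] at key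
  have key' := le_of_pow_le_pow_left₀ (Module.finrank_pos (R := ℚ) (M := N)).ne' (by positivity) key
  rw [one_div, Real.rpow_inv_le_iff_of_pos (by positivity) (by positivity) (by positivity),
    Real.rpow_natCast, sq]
  exact key'

theorem finite_setOf_absMulHeight₁_le (F : IntermediateField ℚ Ω) [FiniteDimensional ℚ F] (B : ℝ) :
    {x : Ω | x ∈ F ∧ absMulHeight₁ x ≤ B}.Finite := by
  have : Algebra.IsAlgebraic ℚ Ω := IsAlgClosure.isAlgebraic
  have : NumberField F := {}
  refine ((Northcott.finite_le (h := mulHeight₁ (K := F)) (B ^ Module.finrank ℚ F)).image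
    Subtype.val).subset ?_
  rintro x ⟨hx, hB⟩
  have hxF : ℚ⟮x⟯ ≤ F := adjoin_simple_le_iff.mpr hx
  refine ⟨⟨x, hx⟩, ?_, rfl⟩
  have h := absMulHeight₁_pow_finrank (Algebra.IsIntegral.isIntegral (R := ℚ) x)
    (inclusion hxF).toRingHom
  exact h.symm.trans_le (pow_le_pow_left₀ (absMulHeight₁_nonneg x) hB _)

end NumberField

open NumberField

theorem theorem1p4 {Ω : Type*} [Field Ω] [CharZero Ω] [IsAlgClosure ℚ Ω]
    (K : IntermediateField ℚ Ω) [NumberField K]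
    (p : ℕ → ℕ) (hp : ∀ i, (p i).Prime)
    (D : ℕ → ℤ[X]) (hmonic : ∀ i, (D i).Monic)
    (heis : ∀ i, (D i).IsEisensteinAt (Ideal.span {(p i : ℤ)}))
    (α : ℕ → Ω) (hroot : ∀ i, aeval (α i) (D i) = 0)
    (hdisc : ∀ i j, j < i → ¬ (p i : ℤ) ∣ NumberField.discr ℚ⟮α j⟯)
    (hlim : Tendsto (fun i ↦ (p i : ℝ) ^ (1 / ((D i).natDegree : ℝ))) atTop atTop) :
    HasNorthcottProperty (adjoin K (Set.range α) : Set Ω) := by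
  let E (n : ℕ) : Option (Fin n) → IntermediateField ℚ Ω := fun o ↦ o.elim K fun j ↦ ℚ⟮α j⟯
  have hnf (n : ℕ) : ∀ o, NumberField (E n o)
    | none => ‹NumberField K›
    | some j => numberField_adjoin_simple (α j)
  let F (n : ℕ) : IntermediateField ℚ Ω := ⨆ o, E n o
  have hfin (n : ℕ) : FiniteDimensional ℚ (F n) := by
    have (o : Option (Fin n)) : FiniteDimensional ℚ (E n o) := (hnf n o).to_finiteDimensional
    exact finiteDimensional_iSup_of_finite
  have hmono : Monotone F := fun m n hmn ↦ iSup_le fun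
    | none => le_iSup (E n) none
    | some j => le_iSup (E n) (some (j.castLE hmn))
  have hsucc (n : ℕ) : F (n + 1) ≤ F n ⊔ ℚ⟮α n⟯ := iSup_le fun
    | none => (le_iSup (E n) none).trans le_sup_left
    | some j => by
      rcases Fin.eq_castSucc_or_eq_last j with ⟨j, rfl⟩ | rfl
      · exact (le_iSup (E n) (some j)).trans le_sup_left
      · exact le_sup_right
  -- The fields `F n` exhaust `K(α₀, α₁, …)`.
  have hexh {x : Ω} (hx : x ∈ adjoin K (Set.range α)) : ∃ n, x ∈ F n := by
    induction hx using adjoin_induction with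
    | mem x hx =>
      obtain ⟨i, rfl⟩ := hx
      exact ⟨i + 1, le_iSup (E (i + 1)) (some (Fin.last i)) (mem_adjoin_simple_self ℚ (α i))⟩
    | algebraMap x => exact ⟨0, le_iSup (E 0) none x.2⟩
    | add x y _ _ hx hy =>
      obtain ⟨m, hm⟩ := hx
      obtain ⟨n, hn⟩ := hy
      exact ⟨max m n, add_mem (hmono (le_max_left m n) hm) (hmono (le_max_right m n) hn)⟩
    | inv x _ hx => exact hx.imp fun _ h ↦ inv_mem h
    | mul x y _ _ hx hy =>
      obtain ⟨m, hm⟩ := hx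
      obtain ⟨n, hn⟩ := hy
      exact ⟨max m n, mul_mem (hmono (le_max_left m n) hm) (hmono (le_max_right m n) hn)⟩
  have hroot_le (i : ℕ) : (p i : ℝ) ^ (1 / ((D i).natDegree : ℝ)) ≤ p i := by
    have hd : (1 : ℝ) ≤ (D i).natDegree :=
      mod_cast natDegree_pos_of_monic_of_aeval_eq_zero (hmonic i) (hroot i)
    exact Real.rpow_le_self_of_one_le (mod_cast (hp i).one_le) (div_le_self zero_le_one hd)
  refine ⟨fun B ↦ ?_⟩
  -- From `n₀` on, `p i` exceeds `|discr K|`, so it is unramified in `K`, and adjoining `α i` adds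
  -- no elements of height at most `B`.
  obtain ⟨n₀, hn₀⟩ := eventually_atTop.mp ((hlim.eventually_gt_atTop (2 * B ^ 2)).and
    (hlim.eventually_gt_atTop ((discr K).natAbs : ℝ)))
  have hdiscK {i : ℕ} (hi : n₀ ≤ i) : ¬ (p i : ℤ) ∣ discr K := fun hdvd ↦ by
    have hle := Nat.le_of_dvd (Int.natAbs_pos.mpr (discr_ne_zero K)) (Int.natCast_dvd.mp hdvd)
    exact ((hn₀ i hi).2.trans_le (hroot_le i)).not_ge (mod_cast hle)
  have hdesc {x : Ω} (hB : absMulHeight₁ x ≤ B) (n : ℕ) (hx : x ∈ F (n₀ + n)) : x ∈ F n₀ := by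
    induction n with
    | zero => exact hx
    | succ n ih =>
      refine ih ?_
      by_contra hxn
      have hle := rpow_le_absMulHeight₁_of_mem_sup_adjoin (E (n₀ + n)) (hp (n₀ + n))
        (fun
          | none => hdiscK (n₀.le_add_right n)
          | some j => hdisc (n₀ + n) j j.2)
        (hmonic _) (heis _) (hroot _) (hsucc (n₀ + n) hx) hxn
      have hlt := (hn₀ (n₀ + n) (n₀.le_add_right n)).1
      have hsq := pow_le_pow_left₀ (absMulHeight₁_nonneg x) hB 2
      linarith
  refine Set.Finite.of_finite_image ((finite_setOf_absMulHeight₁_le (F n₀) B).subset ?_)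
    Subtype.val_injective.injOn
  rintro _ ⟨x, hx, rfl⟩
  obtain ⟨n, hn⟩ := hexh x.2
  exact ⟨hdesc hx n (hmono (Nat.le_add_left n n₀) hn), hx⟩
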